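/- Let $b_1,b_2\in\mathbb R^3$ with $b_1\times b_2\neq 0$, let $k_1,k_2>0$ with $k_1+k_2\le 1$, let $\sigma_1,\sigma_2>0$, and let $\nu$ be a probability measure on $SO(3)$ that is diffusive at the identity: there are a neighbourhood $U$ of $I_d$ and $\varepsilon>0$ with $\nu(A)\ge\varepsilon\,\mu(A)$ for every Borel set $A\subseteq U$, where $\mu$ is Haar measure. Consider the system on $SO(3)$ with two vector measurements $$R_{n+1}=W_nR_n\Omega_n,\qquad Y_n=(R_n^Tb_1+V_n^1,\;R_n^Tb_2+V_n^2),$$ where the inputs $\Omega_n\in SO(3)$ are deterministic, the $W_n$ have law $\nu$, the $V_n^i$ are Gaussian with law $\mathcal N(0,\sigma_i^2I_3)$, and all these noises are independent of each other and of the pair $(R_0,\hat R_0)$, which may have any joint law. Consider the filter $$\hat R'_{n+1}=\hat R_n\Omega_n,\qquad \hat R_{n+1}=K(\hat R'_{n+1}Y_{n+1})\,\hat R'_{n+1},\qquad K(y_1,y_2)=\exp\big(k_1(y_1\times b_1)+k_2(y_2\times b_2)\big),$$ where $\hat R'$ acts on both components of $Y$, and $\exp(x)$ for $x\in\mathbb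 R^3$ is the matrix exponential of the skew-symmetric matrix of $a\mapsto x\times a$. Let $\eta_n=R_n\hat R_n^{-1}$ be the error, which is a homogeneous Markov chain: $$\eta_{n+1}\overset{\mathcal L}{=}\eta'\,K(\eta'^Tb_1+V^1_{n+1},\,\eta'^Tb_2+V^2_{n+1})^{-1},\qquad \eta'=W_n\eta_n .$$ Then this chain has a unique stationary distribution $\pi$ on $SO(3)$, and for every joint law of $(R_0,\hat R_0)$ and every sequence of inputs $(\Omega_n)$ the law $\mu_n$ of $\eta_n$ converges to $\pi$ in total variation: $\|\mu_n-\pi\|_{TV}\to0$. In particular the limit does not depend on the initial distribution. -/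

import Mathlib

open MeasureTheory ProbabilityTheory Filter Topology Matrix

/-- Real vectors with three coordinates. -/
abbrev Vec3 : Type := Fin 3 → ℝ

/-- The rotation group `SO(3)`, as a group of real matrices with the topology of matrix entries. -/
abbrev SO3 : Type := Matrix.specialOrthogonalGroup (Fin 3) ℝ

/-- `SO(3)` carries its Borel sigma-algebra. -/
instance SO3.instMeasurableSpace : MeasurableSpace SO3 := borel SO3

instance SO3.instBorelSpace : BorelSpace SO3 := ⟨rfl⟩

theorem SO3.mul_transpose (g : SO3) : (g : Matrix (Fin 3) (Fin 3) ℝ) * (g : Matrix _ _ ℝ)ᵀ = 1 :=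
  (Matrix.mem_orthogonalGroup_iff _ _).1 (Matrix.mem_specialOrthogonalGroup_iff.1 g.2).1

theorem SO3.coe_inv (g : SO3) :
    ((g⁻¹ : SO3) : Matrix (Fin 3) (Fin 3) ℝ) = (g : Matrix (Fin 3) (Fin 3) ℝ)ᵀ := by
  have h : ((g⁻¹ : SO3) : Matrix (Fin 3) (Fin 3) ℝ) * (g : Matrix (Fin 3) (Fin 3) ℝ) = 1 := by
    have h0 : g⁻¹ * g = 1 := inv_mul_cancel g
    exact congrArg Subtype.val h0
  calc ((g⁻¹ : SO3) : Matrix (Fin 3) (Fin 3) ℝ)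
      = (g⁻¹ : SO3) * ((g : Matrix (Fin 3) (Fin 3) ℝ) * (g : Matrix (Fin 3) (Fin 3) ℝ)ᵀ) := by
        rw [SO3.mul_transpose, mul_one]
    _ = _ := by rw [← mul_assoc, h, one_mul]

instance SO3.instIsTopologicalGroup : IsTopologicalGroup SO3 where
  continuous_mul := continuous_mul
  continuous_inv := by
    refine Continuous.subtype_mk (f := fun g : SO3 => ((g⁻¹ : SO3) : Matrix (Fin 3) (Fin 3) ℝ)) ?_
      fun g => (g⁻¹ : SO3).2
    simp only [SO3.coe_inv]
    exact continuous_subtype_val.matrix_transpose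

instance SO3.instCompactSpace : CompactSpace SO3 := by
  have hK : IsCompact (Set.pi Set.univ fun _ : Fin 3 => Set.pi Set.univ fun _ : Fin 3 =>
      Set.Icc (-1 : ℝ) 1) :=
    isCompact_univ_pi fun _ => isCompact_univ_pi fun _ => isCompact_Icc
  have hset : ((Matrix.specialOrthogonalGroup (Fin 3) ℝ : Submonoid _) :
      Set (Matrix (Fin 3) (Fin 3) ℝ)) = {A | A * Aᵀ = 1} ∩ {A | A.det = 1} := by
    ext A
    simp only [SetLike.mem_coe, Set.mem_inter_iff, Set.mem_ofPred_eq]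
    rw [Matrix.mem_specialOrthogonalGroup_iff, Matrix.mem_orthogonalGroup_iff]
  have hclosed : IsClosed ((Matrix.specialOrthogonalGroup (Fin 3) ℝ : Submonoid _) :
      Set (Matrix (Fin 3) (Fin 3) ℝ)) := by
    rw [hset]
    exact (isClosed_eq (continuous_id.matrix_mul continuous_id.matrix_transpose)
      continuous_const).inter (isClosed_eq continuous_id.matrix_det continuous_const)
  refine isCompact_iff_compactSpace.1 (hK.of_isClosed_subset hclosed ?_)
  intro A hA i _ j _
  have hU : A ∈ Matrix.unitaryGroup (Fin 3) ℝ := (Matrix.mem_specialOrthogonalGroup_iff.1 hA).1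
  have := entry_norm_bound_of_unitary hU i j
  rw [Real.norm_eq_abs] at this
  exact abs_le.1 this

/-- The skew-symmetric matrix of `x`, i.e. the matrix of the linear map `a ↦ x × a`. -/
def skewMatrix (x : Vec3) : Matrix (Fin 3) (Fin 3) ℝ :=
  LinearMap.toMatrix' (crossProduct x)

theorem skewMatrix_mulVec (x a : Vec3) : skewMatrix x *ᵥ a = x ⨯₃ a := by
  rw [skewMatrix, LinearMap.toMatrix'_mulVec]

theorem skewMatrix_transpose (x : Vec3) : (skewMatrix x)ᵀ = -skewMatrix x := by
  ext i j
  fin_cases i <;> fin_cases j <;>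
    simp [skewMatrix, LinearMap.toMatrix'_apply, cross_apply]

theorem exp_skewMatrix_mem (x : Vec3) :
    NormedSpace.exp (skewMatrix x) ∈ Matrix.specialOrthogonalGroup (Fin 3) ℝ := by
  have horth : NormedSpace.exp (skewMatrix x) * (NormedSpace.exp (skewMatrix x))ᵀ = 1 := by
    rw [← Matrix.exp_transpose, skewMatrix_transpose,
      ← Matrix.exp_add_of_commute _ _ (Commute.refl (skewMatrix x)).neg_right, add_neg_cancel,
      NormedSpace.exp_zero]
  have hsq : (NormedSpace.exp (skewMatrix x)).det * (NormedSpace.exp (skewMatrix x)).det = 1 := by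
    have h := congrArg Matrix.det horth
    rwa [Matrix.det_mul, Matrix.det_transpose, Matrix.det_one] at h
  have hhalf : NormedSpace.exp (skewMatrix x) =
      NormedSpace.exp ((1 / 2 : ℝ) • skewMatrix x) * NormedSpace.exp ((1 / 2 : ℝ) • skewMatrix x) := by
    rw [← Matrix.exp_add_of_commute _ _ (Commute.refl _), ← add_smul]
    norm_num
  have hpos : 0 ≤ (NormedSpace.exp (skewMatrix x)).det := by
    rw [hhalf, Matrix.det_mul]
    exact mul_self_nonneg _
  refine Matrix.mem_specialOrthogonalGroup_iff.2 ⟨(Matrix.mem_orthogonalGroup_iff _ _).2 horth, ?_⟩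
  nlinarith

/-- The exponential map of `SO(3)`, with the Lie algebra identified with `ℝ³`. -/
noncomputable def expSO3 (x : Vec3) : SO3 :=
  ⟨NormedSpace.exp (skewMatrix x), exp_skewMatrix_mem x⟩

/-- The action of a rotation on a vector. -/
def SO3.rotate (g : SO3) (v : Vec3) : Vec3 := (g : Matrix (Fin 3) (Fin 3) ℝ) *ᵥ v

/-- The gain function `K(y₁, y₂) = exp (k₁ (y₁ × b₁) + k₂ (y₂ × b₂))`. -/
noncomputable def gain (b₁ b₂ : Vec3) (k₁ k₂ : ℝ) (y₁ y₂ : Vec3) : SO3 :=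
  expSO3 (k₁ • (y₁ ⨯₃ b₁) + k₂ • (y₂ ⨯₃ b₂))

/-- The true attitude: `R (n+1) = W n * R n * Ω n`. -/
def trueAttitude (R₀ : SO3) (W Ω : ℕ → SO3) : ℕ → SO3
  | 0 => R₀
  | n + 1 => W n * trueAttitude R₀ W Ω n * Ω n

/-- The measurement `Rᵀ b + V` of the vector `b`. -/
def observation (R : SO3) (b V : Vec3) : Vec3 := R⁻¹.rotate b + V

/-- One step of the filter: from the estimate `Rhat`, the input `Ω` and the measurements `y₁`, `y₂`
of the next time, form the prediction `Rhat' = Rhat * Ω` and then the new estimate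
`K (Rhat' y₁, Rhat' y₂) * Rhat'`. -/
noncomputable def filterStep (b₁ b₂ : Vec3) (k₁ k₂ : ℝ) (Rhat Ω : SO3) (y₁ y₂ : Vec3) : SO3 :=
  gain b₁ b₂ k₁ k₂ ((Rhat * Ω).rotate y₁) ((Rhat * Ω).rotate y₂) * (Rhat * Ω)

/-- The attitude estimated by the filter. The noises `V₁ n`, `V₂ n` are those of the measurements at
time `n`; the first update uses the measurements at time `1`. -/
noncomputable def estimatedAttitude (b₁ b₂ : Vec3) (k₁ k₂ : ℝ) (R₀ Rhat₀ : SO3) (W Ω : ℕ → SO3)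
    (V₁ V₂ : ℕ → Vec3) : ℕ → SO3
  | 0 => Rhat₀
  | n + 1 => filterStep b₁ b₂ k₁ k₂ (estimatedAttitude b₁ b₂ k₁ k₂ R₀ Rhat₀ W Ω V₁ V₂ n) (Ω n)
      (observation (trueAttitude R₀ W Ω (n + 1)) b₁ (V₁ (n + 1)))
      (observation (trueAttitude R₀ W Ω (n + 1)) b₂ (V₂ (n + 1)))

/-- The invariant error `η n = R n * (Rhat n)⁻¹` of the filter. -/
noncomputable def filterError (b₁ b₂ : Vec3) (k₁ k₂ : ℝ) (R₀ Rhat₀ : SO3) (W Ω : ℕ → SO3)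
    (V₁ V₂ : ℕ → Vec3) (n : ℕ) : SO3 :=
  trueAttitude R₀ W Ω n * (estimatedAttitude b₁ b₂ k₁ k₂ R₀ Rhat₀ W Ω V₁ V₂ n)⁻¹

/-- The centred isotropic Gaussian law on `ℝ³` with covariance matrix `σ² I`. -/
noncomputable def isotropicGaussian (σ : NNReal) : Measure Vec3 :=
  Measure.pi fun _ => gaussianReal 0 (σ ^ 2)

/-- The joint law of the process noise `W n` and the two measurement noises at time `n + 1`:
independent, with laws `ν`, `N(0, σ₁² I)` and `N(0, σ₂² I)`. -/
noncomputable def noiseLaw (ν : Measure SO3) (σ₁ σ₂ : NNReal) : Measure (SO3 × Vec3 × Vec3) :=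
  ν.prod ((isotropicGaussian σ₁).prod (isotropicGaussian σ₂))

/-- Diffusivity of the process noise: near the identity, its law dominates a positive multiple of
Haar measure. (Every neighbourhood of the identity contains a ball around it and conversely.) -/
def IsDiffusive (ν : Measure SO3) : Prop :=
  ∃ U ∈ 𝓝 (1 : SO3), ∃ ε : NNReal, 0 < ε ∧
    ∀ A : Set SO3, MeasurableSet A → A ⊆ U → (ε : ENNReal) * Measure.haar A ≤ ν A

/-- The random map `η n ↦ η (n+1)` of the error Markov chain:
`η' = w η`, then `η' K(η'ᵀ b₁ + v₁, η'ᵀ b₂ + v₂)⁻¹`. -/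
noncomputable def errorStep (b₁ b₂ : Vec3) (k₁ k₂ : ℝ) (η : SO3) (z : SO3 × Vec3 × Vec3) : SO3 :=
  (z.1 * η) * (gain b₁ b₂ k₁ k₂ (observation (z.1 * η) b₁ z.2.1)
    (observation (z.1 * η) b₂ z.2.2))⁻¹

/-- `π` is a stationary distribution of the error Markov chain: if `η` has law `π` and the noise is
independent of `η`, then the next error has law `π` again. -/
def IsStationaryError (b₁ b₂ : Vec3) (k₁ k₂ : ℝ) (ν : Measure SO3) (σ₁ σ₂ : NNReal)
    (π : Measure SO3) : Prop :=
  (π.prod (noiseLaw ν σ₁ σ₂)).map (fun p => errorStep b₁ b₂ k₁ k₂ p.1 p.2) = π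

/-- The total variation norm of the difference of two finite measures. -/
noncomputable def tvNormSub {X : Type*} [MeasurableSpace X] (μ ν : Measure X) [IsFiniteMeasure μ]
    [IsFiniteMeasure ν] : ENNReal :=
  (μ.toSignedMeasure - ν.toSignedMeasure).totalVariation Set.univ

/-! ### Doeblin minorization: stationary laws and convergence in total variation -/

section Doeblin

variable {X : Type*} [MeasurableSpace X]

/-! The error chain satisfies a Doeblin condition in two steps: its kernel `κ` has `δ • m ≤ (κ ∘ₖ κ)
x` for all `x`, with a fixed probability measure `m` and `δ > 0`. Two evolving laws then share a
common part whose missing mass is `(1 - δ) ^ (n / 2)`, which gives existence and uniqueness of the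
stationary law and convergence.

Two steps are needed because `ν` is only controlled near the identity. In the first, the Gaussian
noise makes the measurement update reach every open set: `b₁ ⨯₃ b₂ ≠ 0` lets the exponent of the
gain take every value in ℝ³ (`exists_add_cross_eq`), and `exp` is onto SO(3) (`expSO3_surjective`).
Compactness makes the probability of landing near any target uniformly positive
(`exists_pos_le_measure_errorUpdate`). In the second, the process noise spreads this mass into a
multiple of Haar measure (`smul_haar_le_map_mul`), and the last update carries Haar measure to a
fixed measure, whose normalization is `m`.

The error is an autonomous chain because the inputs and the estimate act on it only by rotating the
measurement noise, whose law is isotropic (`map_systemStep_error`). -/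

theorem tvNormSub_le_of_eq_add (μ ν a b c : Measure X) [IsFiniteMeasure μ] [IsFiniteMeasure ν]
    (hμ : μ = a + c) (hν : ν = b + c) :
    tvNormSub μ ν ≤ a Set.univ + b Set.univ := by
  have ha : IsFiniteMeasure a := isFiniteMeasure_of_le μ (hμ ▸ Measure.le_add_right le_rfl)
  have hb : IsFiniteMeasure b := isFiniteMeasure_of_le ν (hν ▸ Measure.le_add_right le_rfl)
  have hc : IsFiniteMeasure c := isFiniteMeasure_of_le μ (hμ ▸ Measure.le_add_left le_rfl)
  have hs : μ.toSignedMeasure - ν.toSignedMeasure = a.toSignedMeasure - b.toSignedMeasure := by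
    subst hμ hν
    rw [Measure.toSignedMeasure_add, Measure.toSignedMeasure_add]
    abel
  rw [tvNormSub, hs]
  set s := a.toSignedMeasure - b.toSignedMeasure with hsdef
  obtain ⟨i, hi, h₁, h₂, hp, hn⟩ := s.toJordanDecomposition_spec
  have happ : ∀ t, MeasurableSet t → s t = a.real t - b.real t := fun t ht => by
    simp [hsdef, Measure.toSignedMeasure_apply_measurable ht]
  rw [SignedMeasure.totalVariation, Measure.add_apply, hp, hn,
    SignedMeasure.toMeasureOfZeroLE_apply _ _ hi .univ,
    SignedMeasure.toMeasureOfLEZero_apply _ _ hi.compl .univ]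
  -- On the Hahn positive set `i` the mass is `a i - b i ≤ a i`; on its complement the negative part
  -- is `b iᶜ - a iᶜ ≤ b iᶜ`.
  refine add_le_add ?_ ?_
  · refine le_trans ?_ (measure_mono (Set.subset_univ i))
    rw [← ofReal_measureReal, ENNReal.ofReal, ENNReal.coe_le_coe, ← NNReal.coe_le_coe,
      Real.coe_toNNReal _ measureReal_nonneg]
    simp only [Set.inter_univ, NNReal.coe_mk, happ i hi]
    linarith [measureReal_nonneg (μ := b) (s := i)]
  · refine le_trans ?_ (measure_mono (Set.subset_univ iᶜ))
    rw [← ofReal_measureReal, ENNReal.ofReal, ENNReal.coe_le_coe, ← NNReal.coe_le_coe,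
      Real.coe_toNNReal _ measureReal_nonneg]
    simp only [Set.inter_univ, NNReal.coe_mk, happ _ hi.compl]
    linarith [measureReal_nonneg (μ := a) (s := iᶜ)]

/-- Applying a Markov kernel with a Doeblin minorization splits off a multiple of the minorizing
measure. -/
theorem exists_comp_eq_add_smul (K : Kernel X X) [IsMarkovKernel K] (m : Measure X)
    [IsProbabilityMeasure m] (δ : ENNReal) (hδ : δ ≠ ⊤) (hK : ∀ x, δ • m ≤ K x)
    (a : Measure X) [IsFiniteMeasure a] :
    ∃ a' : Measure X, IsFiniteMeasure a' ∧ K ∘ₘ a = a' + (δ * a Set.univ) • m ∧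
      a' Set.univ = (1 - δ) * a Set.univ := by
  have hfin : IsFiniteMeasure ((δ * a Set.univ) • m) :=
    Measure.smul_finite m (ENNReal.mul_ne_top hδ (measure_ne_top a _))
  have hle : (δ * a Set.univ) • m ≤ K ∘ₘ a := by
    refine Measure.le_iff.2 fun s hs => ?_
    rw [Measure.bind_apply hs K.aemeasurable, Measure.smul_apply, smul_eq_mul]
    calc δ * a Set.univ * m s = ∫⁻ _, δ * m s ∂a := by rw [lintegral_const]; ring
      _ ≤ ∫⁻ x, K x s ∂a := lintegral_mono fun x => hK x s
  refine ⟨K ∘ₘ a - (δ * a Set.univ) • m, inferInstance, (Measure.sub_add_cancel_of_le hle).symm, ?_⟩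
  have hu : (K ∘ₘ a) Set.univ = a Set.univ := by
    rw [Measure.bind_apply .univ K.aemeasurable]; simp
  rw [Measure.sub_apply .univ hle, hu, Measure.smul_apply, measure_univ (μ := m), smul_eq_mul, mul_one,
    ENNReal.sub_mul fun _ _ => measure_ne_top a _, one_mul]

/-- The remainders `a` and `b` have equal mass, so at each step both shed the same multiple of `m`.
It joins the common part `c`, and the remainders shrink by the factor `1 - δ`. -/
theorem exists_common_part (K : Kernel X X) [IsMarkovKernel K] (m : Measure X)
    [IsProbabilityMeasure m] (δ : ENNReal) (hδ : δ ≠ ⊤) (hK : ∀ x, δ • m ≤ K x)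
    (u v : ℕ → Measure X) [IsProbabilityMeasure (u 0)] [IsProbabilityMeasure (v 0)]
    (hu : ∀ n, u (n + 1) = K ∘ₘ u n) (hv : ∀ n, v (n + 1) = K ∘ₘ v n) (n : ℕ) :
    ∃ a b c : Measure X, IsFiniteMeasure a ∧ IsFiniteMeasure b ∧ u n = a + c ∧ v n = b + c ∧
      a Set.univ = (1 - δ) ^ n ∧ b Set.univ = (1 - δ) ^ n := by
  induction n with
  | zero => exact ⟨u 0, v 0, 0, inferInstance, inferInstance, by simp, by simp, by simp, by simp⟩
  | succ n ih =>
    obtain ⟨a, b, c, ha, hb, h₁, h₂, h₃, h₄⟩ := ih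
    obtain ⟨a', ha', ea, ea'⟩ := exists_comp_eq_add_smul K m δ hδ hK a
    obtain ⟨b', hb', eb, eb'⟩ := exists_comp_eq_add_smul K m δ hδ hK b
    refine ⟨a', b', (δ * (1 - δ) ^ n) • m + K ∘ₘ c, ha', hb', ?_, ?_, ?_, ?_⟩
    · rw [hu, h₁, Measure.comp_add, ea, h₃, add_assoc]
    · rw [hv, h₂, Measure.comp_add, eb, h₄, add_assoc]
    · rw [ea', h₃, pow_succ']
    · rw [eb', h₄, pow_succ']

/-- Start from `a 0 = m` and let `a (n + 1)` be what remains of `K ∘ₘ a n` after shedding `δ (1 - δ)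
^ n • m`. Then `δ • ∑ a n` is invariant: `K` shifts the sum, and the shed pieces add up to the lost
term `m`. -/
theorem exists_invariant_of_minorization (K : Kernel X X) [IsMarkovKernel K] (m : Measure X)
    [IsProbabilityMeasure m] (δ : ENNReal) (hδ0 : δ ≠ 0) (hδ : δ ≤ 1) (hK : ∀ x, δ • m ≤ K x) :
    ∃ π : Measure X, IsProbabilityMeasure π ∧ K ∘ₘ π = π := by
  have hδt : δ ≠ ⊤ := ne_top_of_le_ne_top ENNReal.one_ne_top hδ
  choose f hf hfe hfu using fun a : {a : Measure X // IsFiniteMeasure a} =>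
    haveI := a.2; exists_comp_eq_add_smul K m δ hδt hK a.1
  let a : ℕ → {a : Measure X // IsFiniteMeasure a} := fun n =>
    (fun b => ⟨f b, hf b⟩)^[n] ⟨m, inferInstance⟩
  have ha0 : (a 0).1 = m := rfl
  have has : ∀ n, (a (n + 1)).1 = f (a n) := fun n =>
    congrArg Subtype.val (Function.iterate_succ_apply' _ n _)
  have hau : ∀ n, (a n).1 Set.univ = (1 - δ) ^ n := fun n => by
    induction n with
    | zero => simp [ha0]
    | succ n ih => rw [has, hfu, ih, pow_succ']
  have hgeom : δ * ∑' n, (1 - δ) ^ n = 1 := by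
    rw [ENNReal.tsum_geometric, ENNReal.sub_sub_cancel ENNReal.one_ne_top hδ,
      ENNReal.mul_inv_cancel hδ0 hδt]
  refine ⟨δ • Measure.sum fun n => (a n).1, ⟨?_⟩, ?_⟩
  · rw [Measure.smul_apply, Measure.sum_apply _ .univ, smul_eq_mul]
    simp only [hau, hgeom]
  · rw [Measure.comp_smul, Measure.bind_sum _ _ K.aemeasurable]
    congr 1
    ext s hs
    have hstep : ∀ n, (K ∘ₘ (a n).1) s = (a (n + 1)).1 s + δ * (1 - δ) ^ n * m s := fun n => by
      rw [hfe, has, Measure.add_apply, hau, Measure.smul_apply, smul_eq_mul]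
    rw [Measure.sum_apply _ hs, Measure.sum_apply _ hs, tsum_congr hstep, ENNReal.tsum_add,
      ENNReal.tsum_mul_right, ENNReal.tsum_mul_left, hgeom, one_mul, add_comm,
      tsum_eq_zero_add' (f := fun n => (a n).1 s) ENNReal.summable, ha0]

/-- View both laws as constant orbits: for every `n` they agree up to a remainder of mass `(1 - δ) ^
n`. -/
theorem invariant_le_of_minorization (K : Kernel X X) [IsMarkovKernel K] (m : Measure X)
    [IsProbabilityMeasure m] (δ : ENNReal) (hδ0 : δ ≠ 0) (hδ : δ ≤ 1) (hK : ∀ x, δ • m ≤ K x)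
    (π π' : Measure X) [IsProbabilityMeasure π] [IsProbabilityMeasure π'] (h : K ∘ₘ π = π)
    (h' : K ∘ₘ π' = π') : π ≤ π' := by
  refine Measure.le_iff.2 fun s _ => ?_
  have hle : ∀ n : ℕ, π s ≤ π' s + (1 - δ) ^ n := fun n => by
    obtain ⟨a, b, c, -, -, h₁, h₂, h₃, -⟩ := exists_common_part K m δ
      (ne_top_of_le_ne_top ENNReal.one_ne_top hδ) hK
      (fun _ => π) (fun _ => π') (fun _ => h.symm) (fun _ => h'.symm) n
    rw [h₁, h₂, ← h₃, Measure.add_apply, Measure.add_apply, add_comm (a s)]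
    exact add_le_add le_add_self (measure_mono (Set.subset_univ s))
  have ht := (ENNReal.tendsto_pow_atTop_nhds_zero_of_lt_one
    (ENNReal.sub_lt_self ENNReal.one_ne_top one_ne_zero hδ0)).const_add (π' s)
  rw [add_zero] at ht
  exact ge_of_tendsto' ht hle

variable (κ : Kernel X X) [IsMarkovKernel κ] (m : Measure X) [IsProbabilityMeasure m]
  (δ : ENNReal)

/-- Along each parity class of times the laws evolve under `κ ∘ₖ κ`; hence the integer quotient `n /
2` in the exponent. -/
theorem exists_common_part_of_two_step (hδ : δ ≤ 1) (hκ : ∀ x, δ • m ≤ (κ ∘ₖ κ) x)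
    (u v : ℕ → Measure X) [IsProbabilityMeasure (u 0)] [IsProbabilityMeasure (v 0)]
    (hu : ∀ n, u (n + 1) = κ ∘ₘ u n) (hv : ∀ n, v (n + 1) = κ ∘ₘ v n) (n : ℕ) :
    ∃ a b c : Measure X, u n = a + c ∧ v n = b + c ∧
      a Set.univ = (1 - δ) ^ (n / 2) ∧ b Set.univ = (1 - δ) ^ (n / 2) := by
  have hδt : δ ≠ ⊤ := ne_top_of_le_ne_top ENNReal.one_ne_top hδ
  have two : ∀ w : ℕ → Measure X, (∀ n, w (n + 1) = κ ∘ₘ w n) →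
      ∀ n, w (n + 2) = (κ ∘ₖ κ) ∘ₘ w n := fun w hw n => by
    rw [hw, hw, Measure.comp_assoc]
  have hp : ∀ w : ℕ → Measure X, (∀ n, w (n + 1) = κ ∘ₘ w n) → IsProbabilityMeasure (w 0) →
      ∀ n, IsProbabilityMeasure (w n) := fun w hw h0 n => by
    induction n with
    | zero => exact h0
    | succ n ih => rw [hw]; infer_instance
  have key : ∀ r q, ∃ a b c : Measure X, u (2 * q + r) = a + c ∧ v (2 * q + r) = b + c ∧
      a Set.univ = (1 - δ) ^ q ∧ b Set.univ = (1 - δ) ^ q := fun r q => by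
    have h₁ : IsProbabilityMeasure (u (2 * 0 + r)) := hp u hu inferInstance _
    have h₂ : IsProbabilityMeasure (v (2 * 0 + r)) := hp v hv inferInstance _
    obtain ⟨a, b, c, -, -, h⟩ := exists_common_part (κ ∘ₖ κ) m δ hδt hκ
      (fun q => u (2 * q + r)) (fun q => v (2 * q + r))
      (fun n => by rw [← two u hu]; congr 1; ring) (fun n => by rw [← two v hv]; congr 1; ring) q
    exact ⟨a, b, c, h⟩
  have := key (n % 2) (n / 2)
  rwa [Nat.div_add_mod] at this

theorem tendsto_one_sub_pow_half {δ : ENNReal} (hδ0 : δ ≠ 0) :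
    Tendsto (fun n : ℕ => (1 - δ) ^ (n / 2)) atTop (𝓝 0) :=
  (ENNReal.tendsto_pow_atTop_nhds_zero_of_lt_one
    (ENNReal.sub_lt_self ENNReal.one_ne_top one_ne_zero hδ0)).comp
    (Nat.tendsto_div_const_atTop two_ne_zero)

theorem invariant_unique_of_two_step (hδ0 : δ ≠ 0) (hδ : δ ≤ 1)
    (hκ : ∀ x, δ • m ≤ (κ ∘ₖ κ) x) (π π' : Measure X) [IsProbabilityMeasure π]
    [IsProbabilityMeasure π'] (h : κ ∘ₘ π = π) (h' : κ ∘ₘ π' = π') : π = π' := by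
  have e : (κ ∘ₖ κ) ∘ₘ π = π := by rw [← Measure.comp_assoc, h, h]
  have e' : (κ ∘ₖ κ) ∘ₘ π' = π' := by rw [← Measure.comp_assoc, h', h']
  exact le_antisymm (invariant_le_of_minorization _ m δ hδ0 hδ hκ _ _ e e')
    (invariant_le_of_minorization _ m δ hδ0 hδ hκ _ _ e' e)

/-- If `π` is invariant under `κ ∘ₖ κ`, so is `κ ∘ₘ π`; uniqueness for the two-step kernel
identifies them. -/
theorem exists_invariant_of_two_step (hδ0 : δ ≠ 0) (hδ : δ ≤ 1)
    (hκ : ∀ x, δ • m ≤ (κ ∘ₖ κ) x) :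
    ∃ π : Measure X, IsProbabilityMeasure π ∧ κ ∘ₘ π = π := by
  obtain ⟨π, hπ, h⟩ := exists_invariant_of_minorization (κ ∘ₖ κ) m δ hδ0 hδ hκ
  refine ⟨π, hπ, ?_⟩
  have h' : (κ ∘ₖ κ) ∘ₘ (κ ∘ₘ π) = κ ∘ₘ π := by
    rw [← Measure.comp_assoc, Measure.comp_assoc (μ := π), h]
  exact le_antisymm (invariant_le_of_minorization _ m δ hδ0 hδ hκ _ _ h' h)
    (invariant_le_of_minorization _ m δ hδ0 hδ hκ _ _ h h')

theorem tendsto_tvNormSub_of_two_step (hδ0 : δ ≠ 0) (hδ : δ ≤ 1)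
    (hκ : ∀ x, δ • m ≤ (κ ∘ₖ κ) x) (π : Measure X) [IsProbabilityMeasure π] (h : κ ∘ₘ π = π)
    (u : ℕ → Measure X) [∀ n, IsFiniteMeasure (u n)] [IsProbabilityMeasure (u 0)]
    (hu : ∀ n, u (n + 1) = κ ∘ₘ u n) :
    Tendsto (fun n => tvNormSub (u n) π) atTop (𝓝 0) := by
  have ht := (tendsto_one_sub_pow_half hδ0).add (tendsto_one_sub_pow_half hδ0)
  rw [add_zero] at ht
  refine tendsto_of_tendsto_of_tendsto_of_le_of_le tendsto_const_nhds ht (fun _ => zero_le)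
    fun n => ?_
  obtain ⟨a, b, c, h₁, h₂, h₃, h₄⟩ := exists_common_part_of_two_step κ m δ hδ hκ u
    (fun _ => π) hu (fun _ => h.symm) n
  have := tvNormSub_le_of_eq_add (u n) π a b c h₁ h₂
  rwa [h₃, h₄] at this

end Doeblin

/-! ### Surjectivity of the exponential onto SO(3) -/

section ExpSurjective

/-- The homomorphism from `ℝ × ℂ` to block diagonal matrices. -/
def blockHom : ℝ × ℂ →+* Matrix (Fin 3) (Fin 3) ℝ where
  toFun p := !![p.1, 0, 0; 0, p.2.re, -p.2.im; 0, p.2.im, p.2.re]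
  map_one' := by
    ext i j; fin_cases i <;> fin_cases j <;> simp
  map_mul' p q := by
    ext i j; fin_cases i <;> fin_cases j <;> simp [Matrix.mul_apply, Fin.sum_univ_three] <;> ring
  map_zero' := by
    ext i j; fin_cases i <;> fin_cases j <;> simp
  map_add' p q := by
    ext i j; fin_cases i <;> fin_cases j <;> simp; ring

theorem blockHom_apply (p : ℝ × ℂ) :
    blockHom p = !![p.1, 0, 0; 0, p.2.re, -p.2.im; 0, p.2.im, p.2.re] := rfl

theorem continuous_blockHom : Continuous blockHom := by
  refine continuous_matrix fun i j => ?_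
  fin_cases i <;> fin_cases j <;> simp [blockHom_apply] <;> fun_prop

/-- A continuous ring homomorphism commutes with `exp`, so the computation takes place in `ℝ × ℂ`.
-/
theorem exp_blockHom (θ : ℝ) :
    NormedSpace.exp (blockHom (0, (θ : ℂ) * Complex.I)) =
      !![1, 0, 0; 0, Real.cos θ, -Real.sin θ; 0, Real.sin θ, Real.cos θ] := by
  have h : blockHom (NormedSpace.exp (0, (θ : ℂ) * Complex.I)) =
      NormedSpace.exp (blockHom (0, (θ : ℂ) * Complex.I)) := by
    open scoped Matrix.Norms.Operator in
    exact NormedSpace.map_exp blockHom continuous_blockHom _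
  rw [← h, blockHom_apply, Prod.fst_exp,
    Prod.snd_exp, NormedSpace.exp_zero, ← Complex.exp_eq_exp_ℂ]
  simp [Complex.exp_ofReal_mul_I_re, Complex.exp_ofReal_mul_I_im]

theorem exists_skewMatrix_eq (S : Matrix (Fin 3) (Fin 3) ℝ) (hS : Sᵀ = -S) :
    ∃ x, skewMatrix x = S := by
  have h : ∀ i j, S j i = -S i j := fun i j => congrFun (congrFun hS i) j
  refine ⟨![S 2 1, S 0 2, S 1 0], ?_⟩
  ext i j
  have h0 := h 0 0
  have h1 := h 1 1
  have h2 := h 2 2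
  have h3 := h 0 1
  have h4 := h 0 2
  have h5 := h 1 2
  fin_cases i <;> fin_cases j <;>
    simp [skewMatrix, LinearMap.toMatrix'_apply, cross_apply] <;> linarith

/-- Householder reflection along `n - e₀`, or the identity when `n = e₀`. Its determinant is
irrelevant, since `g` only serves to conjugate. -/
theorem exists_orthogonal_mulVec_single (n : Fin 3 → ℝ) (hn : n ⬝ᵥ n = 1) :
    ∃ g : Matrix (Fin 3) (Fin 3) ℝ, g * gᵀ = 1 ∧ g *ᵥ Pi.single 0 1 = n := by
  by_cases h0 : n 0 = 1
  · refine ⟨1, by simp, ?_⟩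
    simp only [dotProduct, Fin.sum_univ_three, h0] at hn
    have h1 : n 1 = 0 := by nlinarith [sq_nonneg (n 1), sq_nonneg (n 2)]
    have h2 : n 2 = 0 := by nlinarith [sq_nonneg (n 1), sq_nonneg (n 2)]
    ext i; fin_cases i <;> simp [h0, h1, h2]
  · have hne : 1 - n 0 ≠ 0 := fun h => h0 (by linarith)
    set w : Fin 3 → ℝ := n - Pi.single 0 1 with hw
    have hw2 : w ⬝ᵥ w = 2 * (1 - n 0) := by
      simp only [dotProduct, Fin.sum_univ_three, hw, Pi.sub_apply] at hn ⊢
      simp; linarith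
    set c : ℝ := (1 - n 0)⁻¹ with hc
    have hcw : c * (w ⬝ᵥ w) = 2 := by rw [hw2, hc]; field_simp
    refine ⟨1 - c • vecMulVec w w, ?_, ?_⟩
    · have ht : (1 - c • vecMulVec w w)ᵀ = 1 - c • vecMulVec w w := by
        simp [transpose_vecMulVec]
      rw [ht, sub_mul, mul_sub, mul_sub, one_mul, mul_one, one_mul, smul_mul_smul_comm,
        vecMulVec_mul_vecMulVec, vecMulVec_smul, smul_smul, mul_assoc, hcw, mul_comm c 2, mul_smul,
        two_smul]
      abel
    · ext i
      have hc1 : c * (n 0 - 1) = -1 := by rw [hc]; field_simp; ring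
      have h0w : w 0 = n 0 - 1 := by simp [hw]
      have hwi : n i = w i + Pi.single (M := fun _ => ℝ) 0 1 i := by simp [hw]
      rw [sub_mulVec, one_mulVec, Pi.sub_apply, mulVec_single_one, hwi]
      simp only [col_apply, Matrix.smul_apply, vecMulVec_apply, smul_eq_mul, h0w]
      linear_combination (-w i) * hc1

/-- Euler's theorem: `A` fixes an axis, and moving that axis to `e₀` by conjugation leaves a plane
rotation, which is an exponential. Conjugation commutes with `exp` and preserves skew-symmetry. -/
theorem expSO3_surjective : Function.Surjective expSO3 := by
  intro A
  obtain ⟨A, hA⟩ := A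
  obtain ⟨hO, hdet⟩ := Matrix.mem_specialOrthogonalGroup_iff.1 hA
  have hAA : A * Aᵀ = 1 := (Matrix.mem_orthogonalGroup_iff _ _).1 hO
  have hAA' : Aᵀ * A = 1 := mul_eq_one_comm.1 hAA
  -- As `(A - 1) * Aᵀ = -(A - 1)ᵀ` and the dimension is odd, the determinant equals its own
  -- negative.
  have hd : (A - 1).det = 0 := by
    have h1 : (A - 1).det = ((A - 1) * Aᵀ).det := by
      rw [det_mul, det_transpose, hdet, mul_one]
    have h2 : (A - 1) * Aᵀ = -(A - 1)ᵀ := by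
      rw [sub_mul, hAA]; simp
    rw [h2, det_neg, det_transpose] at h1
    norm_num at h1
    linarith
  obtain ⟨v, hv0, hv⟩ := Matrix.exists_mulVec_eq_zero_iff.2 hd
  have hvv : 0 < v ⬝ᵥ v := by
    have h : 0 ≤ v ⬝ᵥ v := Finset.sum_nonneg fun i _ => mul_self_nonneg (v i)
    exact h.lt_of_ne fun h => hv0 (dotProduct_self_eq_zero.1 h.symm)
  obtain ⟨g, hg, hgn⟩ := exists_orthogonal_mulVec_single ((Real.sqrt (v ⬝ᵥ v))⁻¹ • v) (by
    rw [smul_dotProduct, dotProduct_smul, smul_eq_mul, smul_eq_mul, ← mul_assoc, ← mul_inv,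
      Real.mul_self_sqrt hvv.le, inv_mul_cancel₀ hvv.ne'])
  have hg' : gᵀ * g = 1 := mul_eq_one_comm.1 hg
  have hfix : A *ᵥ (g *ᵥ Pi.single 0 1) = g *ᵥ Pi.single 0 1 := by
    rw [hgn, mulVec_smul]
    rw [sub_mulVec, one_mulVec, sub_eq_zero] at hv
    rw [hv]
  set B := gᵀ * A * g with hB
  have hB1 : B *ᵥ Pi.single 0 1 = Pi.single 0 1 := by
    rw [hB, ← mulVec_mulVec, ← mulVec_mulVec, hfix, mulVec_mulVec, hg', one_mulVec]
  have hBB : B * Bᵀ = 1 := by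
    simp only [hB, transpose_mul, transpose_transpose]
    calc gᵀ * A * g * (gᵀ * (Aᵀ * g)) = gᵀ * (A * (g * gᵀ) * Aᵀ) * g := by simp only [mul_assoc]
      _ = 1 := by rw [hg, mul_one, hAA, mul_one, hg']
  have hBB' : Bᵀ * B = 1 := mul_eq_one_comm.1 hBB
  have hBd : B.det = 1 := by
    have := congrArg det hg
    rw [det_mul, det_transpose, det_one] at this
    rw [hB, det_mul, det_mul, det_transpose, hdet, mul_one, this]
  have hAB : A = g * B * gᵀ := by
    calc A = (g * gᵀ) * A * (g * gᵀ) := by rw [hg]; simp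
      _ = _ := by simp only [hB, mul_assoc]
  have c0 : ∀ i, B i 0 = if i = 0 then 1 else 0 := fun i => by
    have := congrFun hB1 i
    rw [mulVec_single_one] at this
    simpa [Pi.single_apply] using this
  have e : ∀ i j, ∑ k, B i k * B j k = if i = j then 1 else 0 := fun i j => by
    have := congrFun (congrFun hBB i) j
    simpa [mul_apply, one_apply] using this
  have b00 := c0 0
  have b10 := c0 1
  have b20 := c0 2
  have e00 := e 0 0
  have e11 := e 1 1
  have e22 := e 2 2
  have e12 := e 1 2
  simp [Fin.sum_univ_three] at b00 b10 b20 e00 e11 e22 e12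
  rw [det_fin_three] at hBd
  rw [b00] at e00
  rw [b10] at e11
  rw [b20] at e22
  rw [b10, b20] at e12
  have b01 : B 0 1 = 0 := by nlinarith [sq_nonneg (B 0 1), sq_nonneg (B 0 2)]
  have b02 : B 0 2 = 0 := by nlinarith [sq_nonneg (B 0 1), sq_nonneg (B 0 2)]
  rw [b00, b01, b02, b10, b20] at hBd
  -- The two squares in the hints sum to the squared norms of the last two rows minus `2 * det B`,
  -- that is `2 - 2 = 0`.
  have h22 : B 2 2 = B 1 1 := by
    nlinarith [sq_nonneg (B 2 2 - B 1 1), sq_nonneg (B 1 2 + B 2 1)]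
  have h12 : B 1 2 = -B 2 1 := by
    nlinarith [sq_nonneg (B 2 2 - B 1 1), sq_nonneg (B 1 2 + B 2 1)]
  obtain ⟨θ, hc, hs⟩ : ∃ θ : ℝ, Real.cos θ = B 1 1 ∧ Real.sin θ = B 2 1 := by
    have hz : ‖(⟨B 1 1, B 2 1⟩ : ℂ)‖ = 1 := by
      rw [Complex.norm_def, Complex.normSq_mk, Real.sqrt_eq_one]
      rw [h12] at e11; linarith
    refine ⟨Complex.arg ⟨B 1 1, B 2 1⟩, ?_, ?_⟩
    · rw [Complex.cos_arg (fun h => by rw [h] at hz; simp at hz), hz, div_one]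
    · rw [Complex.sin_arg, hz, div_one]
  have hBe : B = NormedSpace.exp (blockHom (0, (θ : ℂ) * Complex.I)) := by
    rw [exp_blockHom, hc, hs]
    ext i j
    fin_cases i <;> fin_cases j <;> simp [b00, b01, b02, b10, b20, h22, h12]
  have hginv : g⁻¹ = gᵀ := inv_eq_right_inv hg
  have hgu : IsUnit g := IsUnit.of_mul_eq_one _ hg
  obtain ⟨x, hx⟩ := exists_skewMatrix_eq (g * blockHom (0, (θ : ℂ) * Complex.I) * gᵀ) (by
    have : (blockHom (0, (θ : ℂ) * Complex.I))ᵀ = -blockHom (0, (θ : ℂ) * Complex.I) := by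
      ext i j
      fin_cases i <;> fin_cases j <;> simp [blockHom_apply]
    simp only [transpose_mul, transpose_transpose, this]
    simp [mul_assoc])
  refine ⟨x, Subtype.ext ?_⟩
  change NormedSpace.exp (skewMatrix x) = A
  rw [hx, ← hginv, Matrix.exp_conj _ _ hgu, ← hBe, hginv, hAB]

end ExpSurjective

/-! ### Continuity of the filter maps -/

section Continuity

theorem continuous_skewMatrix : Continuous skewMatrix := by
  refine continuous_matrix fun i j => ?_
  fin_cases i <;> fin_cases j <;>
    simp [skewMatrix, LinearMap.toMatrix'_apply, cross_apply] <;> fun_prop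

theorem continuous_expSO3 : Continuous expSO3 := by
  refine Continuous.subtype_mk ?_ _
  have h : Continuous (NormedSpace.exp : Matrix (Fin 3) (Fin 3) ℝ → Matrix (Fin 3) (Fin 3) ℝ) := by
    open scoped Matrix.Norms.Operator in
    exact NormedSpace.exp_continuous
  exact h.comp continuous_skewMatrix

theorem continuous_rotate : Continuous fun p : SO3 × Vec3 => p.1.rotate p.2 :=
  (continuous_subtype_val.comp continuous_fst).matrix_mulVec continuous_snd

theorem continuous_observation (b : Vec3) :
    Continuous fun p : SO3 × Vec3 => observation p.1 b p.2 :=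
  (continuous_rotate.comp ((continuous_fst.inv).prodMk continuous_const)).add continuous_snd

theorem continuous_cross_left (b : Vec3) : Continuous fun y : Vec3 => y ⨯₃ b :=
  LinearMap.continuous_of_finiteDimensional (crossProduct.flip b)

theorem continuous_gain (b₁ b₂ : Vec3) (k₁ k₂ : ℝ) :
    Continuous fun p : Vec3 × Vec3 => gain b₁ b₂ k₁ k₂ p.1 p.2 :=
  continuous_expSO3.comp <|
    (((continuous_cross_left b₁).comp continuous_fst).const_smul k₁).add
      (((continuous_cross_left b₂).comp continuous_snd).const_smul k₂)

instance SO3.instSecondCountableTopology : SecondCountableTopology SO3 :=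
  inferInstanceAs (SecondCountableTopology
    {A : Fin 3 → Fin 3 → ℝ // A ∈ Matrix.specialOrthogonalGroup (Fin 3) ℝ})

/-- The measurement update of the error, with measurement noise `v`. -/
noncomputable def errorUpdate (b₁ b₂ : Vec3) (k₁ k₂ : ℝ) (η : SO3) (v : Vec3 × Vec3) : SO3 :=
  η * (gain b₁ b₂ k₁ k₂ (observation η b₁ v.1) (observation η b₂ v.2))⁻¹

theorem errorStep_eq_errorUpdate (b₁ b₂ : Vec3) (k₁ k₂ : ℝ) (η : SO3) (z : SO3 × Vec3 × Vec3) :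
    errorStep b₁ b₂ k₁ k₂ η z = errorUpdate b₁ b₂ k₁ k₂ (z.1 * η) z.2 := rfl

theorem continuous_errorUpdate (b₁ b₂ : Vec3) (k₁ k₂ : ℝ) :
    Continuous fun p : SO3 × Vec3 × Vec3 => errorUpdate b₁ b₂ k₁ k₂ p.1 p.2 := by
  have h₁ : Continuous fun p : SO3 × Vec3 × Vec3 => observation p.1 b₁ p.2.1 := by
    have h : Continuous fun p : SO3 × Vec3 × Vec3 => (p.1, p.2.1) := by fun_prop
    simpa only [Function.comp_def] using (continuous_observation b₁).comp h
  have h₂ : Continuous fun p : SO3 × Vec3 × Vec3 => observation p.1 b₂ p.2.2 := by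
    have h : Continuous fun p : SO3 × Vec3 × Vec3 => (p.1, p.2.2) := by fun_prop
    simpa only [Function.comp_def] using (continuous_observation b₂).comp h
  have h₃ : Continuous fun p : SO3 × Vec3 × Vec3 =>
      gain b₁ b₂ k₁ k₂ (observation p.1 b₁ p.2.1) (observation p.1 b₂ p.2.2) := by
    simpa only [Function.comp_def] using (continuous_gain b₁ b₂ k₁ k₂).comp (h₁.prodMk h₂)
  have h₄ : Continuous fun p : SO3 × Vec3 × Vec3 =>
      (gain b₁ b₂ k₁ k₂ (observation p.1 b₁ p.2.1) (observation p.1 b₂ p.2.2))⁻¹ := h₃.inv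
  simpa only [errorUpdate, Pi.mul_def] using continuous_fst.mul h₄

theorem continuous_errorStep (b₁ b₂ : Vec3) (k₁ k₂ : ℝ) :
    Continuous fun p : SO3 × SO3 × Vec3 × Vec3 => errorStep b₁ b₂ k₁ k₂ p.1 p.2 := by
  have h : Continuous fun p : SO3 × SO3 × Vec3 × Vec3 => (p.2.1 * p.1, p.2.2) :=
    (continuous_snd.fst.mul continuous_fst).prodMk continuous_snd.snd
  simpa only [Function.comp_def, errorStep_eq_errorUpdate] using
    (continuous_errorUpdate b₁ b₂ k₁ k₂).comp h

end Continuity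

/-! ### Irreducibility through the Gaussian measurement noise -/

section Irreducibility

/-- The vectors `u ⨯₃ b` fill the plane orthogonal to `b ≠ 0`, and the planes of two independent
vectors span ℝ³. -/
theorem exists_add_cross_eq {b₁ b₂ : Vec3} (hb : b₁ ⨯₃ b₂ ≠ 0) {k₁ k₂ : ℝ} (hk₁ : k₁ ≠ 0)
    (hk₂ : k₂ ≠ 0) (x : Vec3) : ∃ u₁ u₂ : Vec3, k₁ • (u₁ ⨯₃ b₁) + k₂ • (u₂ ⨯₃ b₂) = x := by
  set c := b₁ ⨯₃ b₂ with hc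
  have hcc : c ⬝ᵥ c ≠ 0 := fun h => hb (dotProduct_self_eq_zero.1 h)
  have hbb : b₁ ⬝ᵥ b₁ ≠ 0 := fun h => hb (by
    rw [hc, dotProduct_self_eq_zero.1 h, map_zero, LinearMap.zero_apply])
  -- Since `b₁ ⬝ᵥ (b₂ ⨯₃ c) = c ⬝ᵥ c`, this `t` makes `p` orthogonal to `b₁`, while `b₂ ⨯₃ c` is
  -- orthogonal to `b₂`.
  set t : ℝ := (x ⬝ᵥ b₁) / (c ⬝ᵥ c) with ht
  have htc : t * (c ⬝ᵥ c) = x ⬝ᵥ b₁ := div_mul_cancel₀ _ hcc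
  set p : Vec3 := x - t • (b₂ ⨯₃ c) with hp
  have hp0 : b₁ ⬝ᵥ p = 0 := by
    rw [hp, dotProduct_sub, dotProduct_smul, triple_product_permutation, triple_product_permutation,
      ← hc, smul_eq_mul, htc, dotProduct_comm, sub_self]
  have hpp : (b₁ ⨯₃ p) ⨯₃ b₁ = (b₁ ⬝ᵥ b₁) • p := by
    simp only [dotProduct, Fin.sum_univ_three] at hp0 ⊢
    ext i
    fin_cases i <;> simp [cross_apply]
    · linear_combination (-b₁ 0) * hp0
    · linear_combination (-b₁ 1) * hp0
    · linear_combination (-b₁ 2) * hp0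
  refine ⟨(k₁⁻¹ * (b₁ ⬝ᵥ b₁)⁻¹) • (b₁ ⨯₃ p), (-(k₂⁻¹ * t)) • c, ?_⟩
  rw [map_smul, map_smul, LinearMap.smul_apply, LinearMap.smul_apply, hpp, smul_smul, smul_smul,
    smul_smul]
  have e₁ : k₁ * (k₁⁻¹ * (b₁ ⬝ᵥ b₁)⁻¹) * (b₁ ⬝ᵥ b₁) = 1 := by field_simp
  have e₂ : k₂ * -(k₂⁻¹ * t) = -t := by field_simp
  rw [e₁, e₂, one_smul, ← cross_anticomm, smul_neg, neg_smul, neg_neg, hp,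
    sub_add_cancel]

theorem exists_errorUpdate_eq {b₁ b₂ : Vec3} (hb : b₁ ⨯₃ b₂ ≠ 0) {k₁ k₂ : ℝ} (hk₁ : k₁ ≠ 0)
    (hk₂ : k₂ ≠ 0) (η y : SO3) : ∃ v, errorUpdate b₁ b₂ k₁ k₂ η v = y := by
  -- The gain has to equal `y⁻¹ * η`; the noise can produce any measurement because it is unbounded.
  obtain ⟨x, hx⟩ := expSO3_surjective (y⁻¹ * η)
  obtain ⟨u₁, u₂, hu⟩ := exists_add_cross_eq hb hk₁ hk₂ x
  refine ⟨(u₁ - η⁻¹.rotate b₁, u₂ - η⁻¹.rotate b₂), ?_⟩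
  simp only [errorUpdate, observation, add_sub_cancel, gain, hu, hx]
  group

/-- Near each `x` an open box `A ×ˢ B` inside `O` gives the lower bound `γ B > 0` on all of `A`;
finitely many such `A` cover the space. -/
theorem exists_pos_le_measure_section {X V : Type*} [TopologicalSpace X] [CompactSpace X]
    [TopologicalSpace V] [MeasurableSpace V] (γ : Measure V) [γ.IsOpenPosMeasure]
    (O : Set (X × V)) (hO : IsOpen O) (h : ∀ x, ∃ v, (x, v) ∈ O) :
    ∃ c : ENNReal, c ≠ 0 ∧ ∀ x, c ≤ γ {v | (x, v) ∈ O} := by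
  suffices H : ∃ c : ENNReal, c ≠ 0 ∧ ∀ x ∈ Set.univ, c ≤ γ {v | (x, v) ∈ O} by
    simpa using H
  refine isCompact_univ.induction_on (p := fun s : Set X => ∃ c : ENNReal, c ≠ 0 ∧ ∀ x ∈ s,
    c ≤ γ {v | (x, v) ∈ O}) ⟨1, one_ne_zero, by simp⟩ ?_ ?_ ?_
  · rintro s t hst ⟨c, hc, h⟩
    exact ⟨c, hc, fun x hx => h x (hst hx)⟩
  · rintro s t ⟨c, hc, h⟩ ⟨d, hd, h'⟩
    refine ⟨min c d, (lt_min (pos_iff_ne_zero.2 hc) (pos_iff_ne_zero.2 hd)).ne', ?_⟩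
    rintro x (hx | hx)
    · exact (min_le_left _ _).trans (h x hx)
    · exact (min_le_right _ _).trans (h' x hx)
  · intro x _
    obtain ⟨v, hv⟩ := h x
    obtain ⟨A, B, hA, hB, hxA, hvB, hAB⟩ := isOpen_prod_iff.1 hO x v hv
    exact ⟨A, mem_nhdsWithin_of_mem_nhds (hA.mem_nhds hxA), γ B, (hB.measure_pos γ ⟨v, hvB⟩).ne',
      fun y hy => measure_mono fun w hw => hAB ⟨hy, hw⟩⟩

theorem isOpenPosMeasure_isotropicGaussian {σ : NNReal} (hσ : 0 < σ) :
    (isotropicGaussian σ).IsOpenPosMeasure := by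
  have : (gaussianReal 0 (σ ^ 2)).IsOpenPosMeasure :=
    (gaussianReal_absolutelyContinuous' 0 (pow_ne_zero 2 hσ.ne')).isOpenPosMeasure
  rw [isotropicGaussian]
  infer_instance

instance (σ : NNReal) : IsProbabilityMeasure (isotropicGaussian σ) := by
  rw [isotropicGaussian]; infer_instance

/-- The joint law of the two measurement noises. -/
noncomputable def measurementLaw (σ₁ σ₂ : NNReal) : Measure (Vec3 × Vec3) :=
  (isotropicGaussian σ₁).prod (isotropicGaussian σ₂)

instance (σ₁ σ₂ : NNReal) : IsProbabilityMeasure (measurementLaw σ₁ σ₂) := by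
  rw [measurementLaw]; infer_instance

instance (ν : Measure SO3) [IsProbabilityMeasure ν] (σ₁ σ₂ : NNReal) :
    IsProbabilityMeasure (noiseLaw ν σ₁ σ₂) := by
  rw [noiseLaw]; infer_instance

/-- Compactness is applied to the pair `(η, y)`, so that `c` depends neither on the start nor on the
target. -/
theorem exists_pos_le_measure_errorUpdate {b₁ b₂ : Vec3} (hb : b₁ ⨯₃ b₂ ≠ 0) {k₁ k₂ : ℝ}
    (hk₁ : k₁ ≠ 0) (hk₂ : k₂ ≠ 0) {σ₁ σ₂ : NNReal} (hσ₁ : 0 < σ₁) (hσ₂ : 0 < σ₂)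
    {U : Set SO3} (hU : IsOpen U) (h1 : 1 ∈ U) :
    ∃ c : ENNReal, c ≠ 0 ∧ ∀ η y : SO3,
      c ≤ measurementLaw σ₁ σ₂ {v | y * (errorUpdate b₁ b₂ k₁ k₂ η v)⁻¹ ∈ U} := by
  have i₁ := isOpenPosMeasure_isotropicGaussian hσ₁
  have i₂ := isOpenPosMeasure_isotropicGaussian hσ₂
  have : (measurementLaw σ₁ σ₂).IsOpenPosMeasure := by rw [measurementLaw]; infer_instance
  have hcont : Continuous fun q : (SO3 × SO3) × Vec3 × Vec3 =>
      q.1.2 * (errorUpdate b₁ b₂ k₁ k₂ q.1.1 q.2)⁻¹ :=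
    (continuous_snd.comp continuous_fst).mul ((continuous_errorUpdate b₁ b₂ k₁ k₂).comp
      ((continuous_fst.comp continuous_fst).prodMk continuous_snd)).inv
  obtain ⟨c, hc, h⟩ := exists_pos_le_measure_section (X := SO3 × SO3) (measurementLaw σ₁ σ₂) _
    (hU.preimage hcont) (fun p => by
      obtain ⟨v, hv⟩ := exists_errorUpdate_eq hb hk₁ hk₂ p.1 p.2
      exact ⟨v, by simpa [hv] using h1⟩)
  exact ⟨c, hc, fun η y => h (η, y)⟩

end Irreducibility

/-! ### The two-step minorization -/

section Minorization

/-- The Markov kernel of the random map `x ↦ F (x, z)`, with `z` of law `ρ`. -/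
noncomputable def randomMapKernel {X Z Y : Type*} [MeasurableSpace X] [MeasurableSpace Z]
    [MeasurableSpace Y] (F : X × Z → Y) (ρ : Measure Z) : Kernel X Y :=
  (Kernel.id ×ₖ Kernel.const X ρ).map F

section

variable {X Z Y : Type*} [MeasurableSpace X] [MeasurableSpace Z] [MeasurableSpace Y]
  {F : X × Z → Y} (hF : Measurable F) (ρ : Measure Z) [IsProbabilityMeasure ρ]

include hF

theorem isMarkovKernel_randomMapKernel : IsMarkovKernel (randomMapKernel F ρ) :=
  Kernel.IsMarkovKernel.map _ hF

theorem randomMapKernel_apply (x : X) {s : Set Y} (hs : MeasurableSet s) :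
    randomMapKernel F ρ x s = ρ {z | F (x, z) ∈ s} := by
  rw [randomMapKernel, Kernel.map_apply' _ hF _ hs, Kernel.prod_apply, Kernel.id_apply,
    Kernel.const_apply, Measure.dirac_prod, Measure.map_apply measurable_prodMk_left (hF hs)]
  rfl

theorem comp_randomMapKernel (μ : Measure X) [SFinite μ] :
    randomMapKernel F ρ ∘ₘ μ = (μ.prod ρ).map F := by
  ext s hs
  rw [Measure.bind_apply hs (Kernel.aemeasurable _), Measure.map_apply hF hs,
    Measure.prod_apply (hF hs)]
  exact lintegral_congr fun x => randomMapKernel_apply hF ρ x hs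

end

theorem measurable_errorStep (b₁ b₂ : Vec3) (k₁ k₂ : ℝ) :
    Measurable fun p : SO3 × SO3 × Vec3 × Vec3 => errorStep b₁ b₂ k₁ k₂ p.1 p.2 :=
  (continuous_errorStep b₁ b₂ k₁ k₂).measurable

theorem measurable_errorUpdate (b₁ b₂ : Vec3) (k₁ k₂ : ℝ) :
    Measurable fun p : SO3 × Vec3 × Vec3 => errorUpdate b₁ b₂ k₁ k₂ p.1 p.2 :=
  (continuous_errorUpdate b₁ b₂ k₁ k₂).measurable

/-- Compact groups are unimodular: a right translate of Haar measure is a multiple of it with the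
same finite nonzero mass. -/
instance isMulRightInvariant_haar_of_compactSpace {G : Type*} [Group G] [TopologicalSpace G]
    [IsTopologicalGroup G] [CompactSpace G] [MeasurableSpace G] [BorelSpace G] :
    (Measure.haar : Measure G).IsMulRightInvariant := by
  refine ⟨fun g => ?_⟩
  have h := Measure.isMulInvariant_eq_smul_of_compactSpace
    (Measure.map (· * g) (Measure.haar : Measure G)) Measure.haar
  have hu := congrArg (fun μ : Measure G => μ Set.univ) h
  simp only [Measure.map_apply (measurable_mul_const g) .univ, Set.preimage_univ] at hu
  rw [h]
  generalize Measure.haarScalarFactor (Measure.map (· * g) (Measure.haar : Measure G))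
    Measure.haar = r at hu ⊢
  have hne : (Measure.haar : Measure G) Set.univ ≠ 0 :=
    (isOpen_univ.measure_pos _ Set.univ_nonempty).ne'
  have hr : (r : ENNReal) = 1 := by
    have : (r : ENNReal) * (Measure.haar : Measure G) Set.univ =
        1 * (Measure.haar : Measure G) Set.univ := by
      rw [one_mul]; exact hu.symm
    exact (ENNReal.mul_left_inj hne (measure_ne_top _ _)).1 this
  have hr' : r = 1 := by exact_mod_cast hr
  rw [hr', one_smul]

/-- Multiplying on the left by a random element whose law dominates Haar measure near the identity
turns a law giving enough mass to every translate of a neighbourhood of the identity into a law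
dominating Haar measure. -/
theorem smul_haar_le_map_mul {G : Type*} [Group G] [TopologicalSpace G]
    [IsTopologicalGroup G] [CompactSpace G] [SecondCountableTopology G] [MeasurableSpace G]
    [BorelSpace G] (ν ρ : Measure G) [SFinite ν] [SFinite ρ] {U : Set G} (hU : MeasurableSet U)
    (ε c : ENNReal) (hν : ∀ A, MeasurableSet A → A ⊆ U → ε * Measure.haar A ≤ ν A)
    (hρ : ∀ y, c ≤ ρ {x | y * x⁻¹ ∈ U}) :
    (ε * c) • Measure.haar ≤ (ρ.prod ν).map fun p => p.2 * p.1 := by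
  refine Measure.le_iff.2 fun A hA => ?_
  have hm : Measurable fun p : G × G => p.2 * p.1 := measurable_snd.mul measurable_fst
  have hm' : Measurable fun p : G × G => p.2 * p.1⁻¹ := measurable_snd.mul measurable_fst.inv
  have hS : MeasurableSet {p : G × G | p.2 ∈ A ∧ p.2 * p.1⁻¹ ∈ U} :=
    (measurable_snd hA).inter (hm' hU)
  rw [Measure.map_apply hm hA, Measure.prod_apply (hm hA), Measure.smul_apply, smul_eq_mul]
  calc ε * c * Measure.haar A = ε * ∫⁻ _ in A, c ∂Measure.haar := by
        rw [setLIntegral_const, mul_assoc]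
    _ ≤ ε * ∫⁻ y, ρ {x | y ∈ A ∧ y * x⁻¹ ∈ U} ∂Measure.haar := by
        rw [← lintegral_indicator hA]
        gcongr with y
        by_cases hy : y ∈ A
        · simpa [hy] using hρ y
        · simp [hy]
    _ = ε * ∫⁻ x, Measure.haar {y | y ∈ A ∧ y * x⁻¹ ∈ U} ∂ρ := by
        congr 1
        exact (Measure.prod_apply_symm (μ := ρ) hS).symm.trans (Measure.prod_apply hS)
    _ ≤ ∫⁻ x, ε * Measure.haar {y | y ∈ A ∧ y * x⁻¹ ∈ U} ∂ρ := lintegral_const_mul_le _ _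
    _ ≤ ∫⁻ x, ν (Prod.mk x ⁻¹' ((fun p : G × G => p.2 * p.1) ⁻¹' A)) ∂ρ := by
        refine lintegral_mono fun x => ?_
        -- Substitute `y = w * x`: right invariance turns `y * x⁻¹ ∈ U` into `w ∈ U`, where `ν`
        -- dominates `ε` times Haar measure.
        rw [← measure_preimage_mul_right Measure.haar x]
        refine (hν _ (measurable_mul_const x (hA.inter
          (measurable_mul_const x⁻¹ hU))) ?_).trans (measure_mono ?_)
        · rintro w ⟨-, hw⟩
          simpa using hw
        · rintro w ⟨hw, -⟩
          exact hw

/-- Factor `κ` as left multiplication by `ν`-noise followed by the update `q`. In `κ ∘ₖ κ`, the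
first `κ` spreads mass near every target, the second multiplication smooths it to at least `ε * c`
times Haar measure, and the final `q` is merely carried along. -/
theorem exists_two_step_minorization {b₁ b₂ : Vec3} (hb : b₁ ⨯₃ b₂ ≠ 0) {k₁ k₂ : ℝ}
    (hk₁ : k₁ ≠ 0) (hk₂ : k₂ ≠ 0) {σ₁ σ₂ : NNReal} (hσ₁ : 0 < σ₁) (hσ₂ : 0 < σ₂)
    (ν : Measure SO3) [IsProbabilityMeasure ν] (hν : IsDiffusive ν)
    (κ : Kernel SO3 SO3)
    (hκ : κ = randomMapKernel (fun p => errorStep b₁ b₂ k₁ k₂ p.1 p.2) (noiseLaw ν σ₁ σ₂)) :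
    ∃ (m : Measure SO3) (δ : ENNReal), IsProbabilityMeasure m ∧ δ ≠ 0 ∧ δ ≤ 1 ∧
      ∀ x, δ • m ≤ (κ ∘ₖ κ) x := by
  obtain ⟨U₀, hU₀, ε, hε, hνU⟩ := hν
  obtain ⟨U, hUU₀, hU, h1⟩ := mem_nhds_iff.1 hU₀
  obtain ⟨c, hc, hcU⟩ := exists_pos_le_measure_errorUpdate hb hk₁ hk₂ hσ₁ hσ₂ hU h1
  set γ := measurementLaw σ₁ σ₂ with hγ
  have hF := measurable_errorStep b₁ b₂ k₁ k₂
  have hG := measurable_errorUpdate b₁ b₂ k₁ k₂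
  have hκM : IsMarkovKernel κ := hκ ▸ isMarkovKernel_randomMapKernel hF _
  let q : Kernel SO3 SO3 := randomMapKernel (fun p => errorUpdate b₁ b₂ k₁ k₂ p.1 p.2) γ
  have hqM : IsMarkovKernel q := isMarkovKernel_randomMapKernel hG γ
  have hκq : ∀ (x : SO3) (s : Set SO3), MeasurableSet s → κ x s = ∫⁻ w, q (w * x) s ∂ν := by
    intro x s hs
    have hs' : MeasurableSet {z : SO3 × Vec3 × Vec3 | errorStep b₁ b₂ k₁ k₂ x z ∈ s} :=
      (hF.comp measurable_prodMk_left) hs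
    rw [hκ, randomMapKernel_apply hF _ _ hs, noiseLaw, Measure.prod_apply hs']
    exact lintegral_congr fun w => (randomMapKernel_apply hG γ (w * x) hs).symm
  -- The bound for the update is uniform in its starting point, hence survives averaging over the
  -- process noise.
  have hirr : ∀ x y, c ≤ κ x {x' | y * x'⁻¹ ∈ U} := by
    intro x y
    have hs : MeasurableSet {x' : SO3 | y * x'⁻¹ ∈ U} :=
      (hU.preimage (continuous_const.mul continuous_inv)).measurableSet
    rw [hκq x _ hs]
    calc c = ∫⁻ _, c ∂ν := by simp
      _ ≤ _ := lintegral_mono fun w => by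
        rw [randomMapKernel_apply hG γ _ hs]
        exact hcU (w * x) y
  have hle : ∀ x, (ε * c) • (q ∘ₘ Measure.haar) ≤ (κ ∘ₖ κ) x := by
    intro x
    refine Measure.le_iff.2 fun s hs => ?_
    have hm : Measurable fun p : SO3 × SO3 => p.2 * p.1 := measurable_snd.mul measurable_fst
    have hqs : Measurable fun y => q y s := q.measurable_coe hs
    have hqm : Measurable fun p : SO3 × SO3 => q (p.2 * p.1) s := hqs.comp hm
    have hl := smul_haar_le_map_mul ν (κ x) hU.measurableSet ε c
      (fun A hA hAU => hνU A hA (hAU.trans hUU₀)) (hirr x)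
    rw [Measure.smul_apply, smul_eq_mul, Measure.bind_apply hs q.aemeasurable,
      Kernel.comp_apply' _ _ _ hs]
    calc ε * c * ∫⁻ y, q y s ∂Measure.haar = ∫⁻ y, q y s ∂((ε * c) • Measure.haar) := by
          rw [lintegral_smul_measure, smul_eq_mul]
      _ ≤ ∫⁻ y, q y s ∂((κ x).prod ν).map fun p => p.2 * p.1 := lintegral_mono' hl le_rfl
      _ = ∫⁻ x', κ x' s ∂κ x := by
          rw [lintegral_map hqs hm, lintegral_prod _ hqm.aemeasurable]
          exact lintegral_congr fun x' => (hκq x' s hs).symm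
  set H : ENNReal := (Measure.haar : Measure SO3) Set.univ with hH
  have hH0 : H ≠ 0 := (isOpen_univ.measure_pos _ Set.univ_nonempty).ne'
  have hHt : H ≠ ⊤ := measure_ne_top _ _
  have hm : IsProbabilityMeasure (H⁻¹ • (q ∘ₘ (Measure.haar : Measure SO3))) := by
    refine ⟨?_⟩
    rw [Measure.smul_apply, Measure.bind_apply .univ q.aemeasurable]
    simp only [measure_univ, lintegral_const, one_mul, smul_eq_mul]
    exact ENNReal.inv_mul_cancel hH0 hHt
  have hmin : ∀ x, (ε * c * H) • H⁻¹ • (q ∘ₘ (Measure.haar : Measure SO3)) ≤ (κ ∘ₖ κ) x := by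
    intro x
    rw [smul_smul, mul_assoc, ENNReal.mul_inv_cancel hH0 hHt, mul_one]
    exact hle x
  refine ⟨_, ε * c * H, hm, mul_ne_zero (mul_ne_zero (by exact_mod_cast hε.ne') hc) hH0, ?_, hmin⟩
  -- Comparing total masses gives `δ ≤ 1`, since both `m` and the two-step law are probability
  -- measures.
  have := hmin 1 Set.univ
  rwa [Measure.smul_apply, measure_univ, measure_univ, smul_eq_mul, mul_one] at this

end Minorization

/-! ### Rotation invariance of the Gaussian noise -/

section Isotropy

/-- `Vec3` carries the sup norm; invariance under isometries is available for the standard Gaussian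
on Euclidean space, and scaling commutes with rotations. -/
theorem isotropicGaussian_eq_map (σ : NNReal) :
    isotropicGaussian σ = (stdGaussian (EuclideanSpace ℝ (Fin 3))).map
      (fun x => (σ : ℝ) • WithLp.ofLp x) := by
  have h1 : Measurable fun x : Vec3 => (σ : ℝ) • x := measurable_const_smul _
  rw [← map_pi_eq_stdGaussian, Measure.map_map (by fun_prop) (by fun_prop)]
  change _ = (Measure.pi fun _ : Fin 3 => gaussianReal 0 1).map
    (fun (x : Fin 3 → ℝ) i => (σ : ℝ) * x i)
  rw [Measure.pi_map_pi (μ := fun _ : Fin 3 => gaussianReal 0 1) (f := fun _ x => (σ : ℝ) * x)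
    (fun _ => (measurable_const_mul (σ : ℝ)).aemeasurable), isotropicGaussian]
  simp only [gaussianReal_map_const_mul, mul_zero, mul_one]
  congr

theorem rotate_dotProduct_self (g : SO3) (v : Vec3) : g.rotate v ⬝ᵥ g.rotate v = v ⬝ᵥ v := by
  have h : (g : Matrix (Fin 3) (Fin 3) ℝ)ᵀ * (g : Matrix (Fin 3) (Fin 3) ℝ) = 1 :=
    mul_eq_one_comm.1 (SO3.mul_transpose g)
  rw [SO3.rotate, dotProduct_mulVec, ← mulVec_transpose, mulVec_mulVec, h, one_mulVec]

/-- The isometry of Euclidean space given by a rotation. -/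
noncomputable def rotateIsometry (g : SO3) :
    EuclideanSpace ℝ (Fin 3) →ₗᵢ[ℝ] EuclideanSpace ℝ (Fin 3) where
  toLinearMap := Matrix.toEuclideanLin (g : Matrix (Fin 3) (Fin 3) ℝ)
  norm_map' x := by
    rw [← sq_eq_sq₀ (norm_nonneg _) (norm_nonneg _), EuclideanSpace.real_norm_sq_eq,
      EuclideanSpace.real_norm_sq_eq]
    have := rotate_dotProduct_self g (WithLp.ofLp x)
    simpa [dotProduct, SO3.rotate, ← pow_two] using this

theorem map_rotate_isotropicGaussian (σ : NNReal) (g : SO3) :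
    (isotropicGaussian σ).map g.rotate = isotropicGaussian σ := by
  have hg : Measurable g.rotate :=
    (continuous_const.matrix_mulVec continuous_id : Continuous g.rotate).measurable
  have hσ : Measurable fun x : EuclideanSpace ℝ (Fin 3) => (σ : ℝ) • WithLp.ofLp x := by fun_prop
  have h := stdGaussian_map ((rotateIsometry g).toLinearIsometryEquiv rfl)
  have hm : Measurable ((rotateIsometry g).toLinearIsometryEquiv rfl) :=
    ((rotateIsometry g).toLinearIsometryEquiv rfl).continuous.measurable
  rw [isotropicGaussian_eq_map, Measure.map_map hg hσ]
  conv_rhs => rw [← h, Measure.map_map hσ hm]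
  congr 1
  ext1 x
  exact mulVec_smul (g : Matrix (Fin 3) (Fin 3) ℝ) (σ : ℝ) (WithLp.ofLp x)

end Isotropy

/-! ### Autonomous recursion for the law of the error -/

section Recursion

theorem rotate_mul (g h : SO3) (v : Vec3) : (g * h).rotate v = g.rotate (h.rotate v) := by
  simp [SO3.rotate, mulVec_mulVec]

theorem rotate_add (g : SO3) (v w : Vec3) : g.rotate (v + w) = g.rotate v + g.rotate w :=
  mulVec_add _ _ _

/-- Equivariance: for `g` the predicted attitude, `R * g⁻¹` is the predicted error, so the filter's
innovation sees the attitude only through the error. -/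
theorem rotate_observation (g R : SO3) (b V : Vec3) :
    g.rotate (observation R b V) = observation (R * g⁻¹) b (g.rotate V) := by
  rw [observation, observation, rotate_add, ← rotate_mul]
  congr 2
  group

/-- One step of the filtered system, for the pair of the true and the estimated attitude. -/
noncomputable def systemStep (b₁ b₂ : Vec3) (k₁ k₂ : ℝ) (Ω : SO3) (p : SO3 × SO3)
    (z : SO3 × Vec3 × Vec3) : SO3 × SO3 :=
  (z.1 * p.1 * Ω, filterStep b₁ b₂ k₁ k₂ p.2 Ω (observation (z.1 * p.1 * Ω) b₁ z.2.1)
    (observation (z.1 * p.1 * Ω) b₂ z.2.2))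

/-- `Ω` cancels in the quotient of the two predictions and survives only in the rotation applied to
the noise. -/
theorem systemStep_error (b₁ b₂ : Vec3) (k₁ k₂ : ℝ) (Ω : SO3) (p : SO3 × SO3)
    (z : SO3 × Vec3 × Vec3) :
    (systemStep b₁ b₂ k₁ k₂ Ω p z).1 * (systemStep b₁ b₂ k₁ k₂ Ω p z).2⁻¹ =
      errorStep b₁ b₂ k₁ k₂ (p.1 * p.2⁻¹)
        (z.1, (p.2 * Ω).rotate z.2.1, (p.2 * Ω).rotate z.2.2) := by
  have h : z.1 * p.1 * Ω * (p.2 * Ω)⁻¹ = z.1 * (p.1 * p.2⁻¹) := by group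
  simp only [systemStep, filterStep, errorStep, rotate_observation, h]
  rw [_root_.mul_inv_rev, ← mul_assoc, h]

theorem continuous_systemStep (b₁ b₂ : Vec3) (k₁ k₂ : ℝ) (Ω : SO3) :
    Continuous fun q : (SO3 × SO3) × SO3 × Vec3 × Vec3 => systemStep b₁ b₂ k₁ k₂ Ω q.1 q.2 := by
  have hR : Continuous fun q : (SO3 × SO3) × SO3 × Vec3 × Vec3 => q.2.1 * q.1.1 * Ω :=
    (continuous_snd.fst.mul continuous_fst.fst).mul continuous_const
  have hE : Continuous fun q : (SO3 × SO3) × SO3 × Vec3 × Vec3 => q.1.2 * Ω :=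
    continuous_fst.snd.mul continuous_const
  have h₁ : Continuous fun q : (SO3 × SO3) × SO3 × Vec3 × Vec3 =>
      (q.1.2 * Ω).rotate (observation (q.2.1 * q.1.1 * Ω) b₁ q.2.2.1) := by
    have h := (continuous_observation b₁).comp (hR.prodMk continuous_snd.snd.fst)
    simpa only [Function.comp_def] using continuous_rotate.comp (hE.prodMk h)
  have h₂ : Continuous fun q : (SO3 × SO3) × SO3 × Vec3 × Vec3 =>
      (q.1.2 * Ω).rotate (observation (q.2.1 * q.1.1 * Ω) b₂ q.2.2.2) := by
    have h := (continuous_observation b₂).comp (hR.prodMk continuous_snd.snd.snd)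
    simpa only [Function.comp_def] using continuous_rotate.comp (hE.prodMk h)
  have hK := (continuous_gain b₁ b₂ k₁ k₂).comp (h₁.prodMk h₂)
  have h := hR.prodMk (hK.mul hE)
  simpa only [systemStep, filterStep, Pi.mul_def, Function.comp_def] using h

theorem noiseLaw_map_rotate (ν : Measure SO3) [IsProbabilityMeasure ν] (σ₁ σ₂ : NNReal) (g : SO3) :
    (noiseLaw ν σ₁ σ₂).map (fun z => (z.1, g.rotate z.2.1, g.rotate z.2.2)) =
      noiseLaw ν σ₁ σ₂ := by
  have hg : Measurable g.rotate :=
    (continuous_const.matrix_mulVec continuous_id : Continuous g.rotate).measurable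
  change (noiseLaw ν σ₁ σ₂).map (Prod.map id (Prod.map g.rotate g.rotate)) = _
  rw [noiseLaw, ← Measure.map_prod_map _ _ measurable_id (hg.prodMap hg),
    ← Measure.map_prod_map _ _ hg hg, Measure.map_id, map_rotate_isotropicGaussian,
    map_rotate_isotropicGaussian]

/-- The law of the next error only depends on the law of the current error. -/
theorem map_systemStep_error (b₁ b₂ : Vec3) (k₁ k₂ : ℝ) (Ω : SO3) (ν : Measure SO3)
    [IsProbabilityMeasure ν] (σ₁ σ₂ : NNReal) (μ : Measure (SO3 × SO3)) [IsProbabilityMeasure μ] :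
    (μ.prod (noiseLaw ν σ₁ σ₂)).map (fun q => (systemStep b₁ b₂ k₁ k₂ Ω q.1 q.2).1 *
        (systemStep b₁ b₂ k₁ k₂ Ω q.1 q.2).2⁻¹) =
      randomMapKernel (fun p => errorStep b₁ b₂ k₁ k₂ p.1 p.2) (noiseLaw ν σ₁ σ₂) ∘ₘ
        μ.map fun p => p.1 * p.2⁻¹ := by
  have hF := measurable_errorStep b₁ b₂ k₁ k₂
  have hS := (continuous_systemStep b₁ b₂ k₁ k₂ Ω).measurable
  have hD : Measurable fun p : SO3 × SO3 => p.1 * p.2⁻¹ := measurable_fst.mul measurable_snd.inv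
  have hSD : Measurable fun q : (SO3 × SO3) × SO3 × Vec3 × Vec3 =>
      (systemStep b₁ b₂ k₁ k₂ Ω q.1 q.2).1 * (systemStep b₁ b₂ k₁ k₂ Ω q.1 q.2).2⁻¹ := hD.comp hS
  ext s hs
  rw [Measure.map_apply hSD hs, Measure.prod_apply (hSD hs),
    Measure.bind_apply hs (Kernel.aemeasurable _),
    lintegral_map (Kernel.measurable_coe _ hs) hD]
  refine lintegral_congr fun p => ?_
  rw [randomMapKernel_apply hF _ _ hs]
  have hrot : Measurable fun z : SO3 × Vec3 × Vec3 =>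
      (z.1, (p.2 * Ω).rotate z.2.1, (p.2 * Ω).rotate z.2.2) := by
    have hg : Measurable (p.2 * Ω).rotate :=
      (continuous_const.matrix_mulVec continuous_id : Continuous (p.2 * Ω).rotate).measurable
    exact measurable_fst.prodMk ((hg.comp measurable_snd.fst).prodMk (hg.comp measurable_snd.snd))
  have hs' : MeasurableSet {z : SO3 × Vec3 × Vec3 |
      errorStep b₁ b₂ k₁ k₂ (p.1 * p.2⁻¹) z ∈ s} := (hF.comp measurable_prodMk_left) hs
  change noiseLaw ν σ₁ σ₂ {z | _ ∈ s} = noiseLaw ν σ₁ σ₂ _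
  -- With the state `p` frozen, the rotation `p.2 * Ω` is deterministic and leaves the noise law
  -- unchanged.
  conv_rhs => rw [← noiseLaw_map_rotate ν σ₁ σ₂ (p.2 * Ω), Measure.map_apply hrot hs']
  simp only [systemStep_error]
  rfl

end Recursion

/-! ### Independence of state and future noise -/

section Independence

/-- Both hypotheses together factor the joint law into three marginals; the conclusion is this
product reassociated. -/
theorem IndepFun.prodMk_left_of_prodMk_right {S α β γ : Type*} [MeasurableSpace S]
    [MeasurableSpace α] [MeasurableSpace β] [MeasurableSpace γ] {P : Measure S}
    [IsProbabilityMeasure P] {X : S → α} {Y : S → β} {Z : S → γ} (hX : Measurable X)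
    (hY : Measurable Y) (hZ : Measurable Z) (h : IndepFun X (fun s => (Y s, Z s)) P)
    (h' : IndepFun Y Z P) : IndepFun (fun s => (X s, Y s)) Z P := by
  have hXY : IndepFun X Y P := h.comp measurable_id measurable_fst
  rw [indepFun_iff_map_prod_eq_prod_map_map (by fun_prop) (by fun_prop)] at h h' hXY ⊢
  have _ := Measure.isProbabilityMeasure_map (μ := P) hX.aemeasurable
  have _ := Measure.isProbabilityMeasure_map (μ := P) hY.aemeasurable
  have _ := Measure.isProbabilityMeasure_map (μ := P) hZ.aemeasurable
  refine MeasurableEquiv.map_measurableEquiv_injective MeasurableEquiv.prodAssoc ?_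
  rw [hXY, Measure.prodAssoc_prod, ← h', ← h,
    Measure.map_map MeasurableEquiv.prodAssoc.measurable (by fun_prop)]
  rfl

theorem indepFun_head_tail {S Z : Type*} [MeasurableSpace S] [MeasurableSpace Z] {P : Measure S}
    {X : ℕ → S → Z} (hX : ∀ n, Measurable (X n)) (h : iIndepFun X P) (n : ℕ) :
    IndepFun (X n) (fun s k => X (n + 1 + k) s) P := by
  have hi := indep_iSup_of_disjoint (fun i => (hX i).comap_le) ((iIndepFun_iff_iIndep _ _ _).1 h)
    (S := {n}) (T := {i | n < i}) (by simp)
  rw [IndepFun_iff_Indep]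
  refine indep_of_indep_of_le_left (indep_of_indep_of_le_right hi ?_) ?_
  · rw [MeasurableSpace.pi, MeasurableSpace.comap_iSup]
    refine iSup_le fun k => ?_
    rw [MeasurableSpace.comap_comp]
    exact le_iSup₂_of_le (n + 1 + k) (by simp; omega) le_rfl
  · exact le_iSup₂_of_le n rfl le_rfl

end Independence

section Assembly

/-- A sequence driven by independent innovations is independent of the future innovations. -/
theorem indepFun_future {S α Z : Type*} [MeasurableSpace S] [MeasurableSpace α]
    [MeasurableSpace Z] {P : Measure S} [IsProbabilityMeasure P] {X : ℕ → S → α} {N : ℕ → S → Z}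
    {F : ℕ → α × Z → α} (hF : ∀ n, Measurable (F n)) (hN : ∀ n, Measurable (N n))
    (hi : iIndepFun N P) (h0 : Measurable (X 0)) (hX0 : IndepFun (X 0) (fun s n => N n s) P)
    (hX : ∀ n s, X (n + 1) s = F n (X n s, N n s)) (n : ℕ) :
    Measurable (X n) ∧ IndepFun (X n) (fun s k => N (n + k) s) P := by
  induction n with
  | zero => exact ⟨h0, by simpa using hX0⟩
  | succ n ih =>
    obtain ⟨hm, hind⟩ := ih
    have hXn : X (n + 1) = F n ∘ fun s => (X n s, N n s) := funext fun s => hX n s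
    have htail : Measurable fun s (k : ℕ) => N (n + 1 + k) s := measurable_pi_lambda _ fun k => hN _
    have hsplit : Measurable fun z : ℕ → Z => (z 0, fun k => z (1 + k)) :=
      (measurable_pi_apply 0).prodMk (measurable_pi_lambda _ fun k => measurable_pi_apply _)
    -- The future from time `n` is split into its head, consumed by the next step, and its tail.
    have h₁ : IndepFun (X n) (fun s => (N n s, fun k => N (n + 1 + k) s)) P := by
      have := hind.comp measurable_id hsplit
      simpa only [Function.comp_def, id, add_zero, ← add_assoc] using this
    refine ⟨hXn ▸ (hF n).comp (hm.prodMk (hN n)), ?_⟩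
    rw [hXn]
    exact (IndepFun.prodMk_left_of_prodMk_right hm (hN n) htail h₁
      (indepFun_head_tail hN hi n)).comp (hF n) measurable_id

end Assembly

/-- For the two-vector attitude filter with noise, the law of the invariant error converges in total
variation to the unique stationary distribution of the error chain, whatever the joint law of the
initial attitude and its initial estimate, and whatever the inputs. -/
theorem mainTheorem3 (b₁ b₂ : Vec3) (hb : b₁ ⨯₃ b₂ ≠ 0)
    (k₁ k₂ : ℝ) (hk₁ : 0 < k₁) (hk₂ : 0 < k₂) (hk : k₁ + k₂ ≤ 1)
    (σ₁ σ₂ : NNReal) (hσ₁ : 0 < σ₁) (hσ₂ : 0 < σ₂)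
    (ν : ProbabilityMeasure SO3) (hν : IsDiffusive ν) :
    ∃ π : ProbabilityMeasure SO3,
      IsStationaryError b₁ b₂ k₁ k₂ ν σ₁ σ₂ π ∧
      (∀ π' : ProbabilityMeasure SO3, IsStationaryError b₁ b₂ k₁ k₂ ν σ₁ σ₂ π' → π' = π) ∧
      ∀ {S : Type*} [MeasurableSpace S] (P : Measure S) [IsProbabilityMeasure P]
        (R₀ Rhat₀ : S → SO3) (W : ℕ → S → SO3) (V₁ V₂ : ℕ → S → Vec3) (Ω : ℕ → SO3),
        Measurable R₀ → Measurable Rhat₀ → (∀ n, Measurable (W n)) →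
        (∀ n, Measurable (V₁ n)) → (∀ n, Measurable (V₂ n)) →
        (∀ n, P.map (fun s => (W n s, V₁ (n + 1) s, V₂ (n + 1) s)) = noiseLaw ν σ₁ σ₂) →
        iIndepFun (fun n s => (W n s, V₁ (n + 1) s, V₂ (n + 1) s)) P →
        IndepFun (fun s => (R₀ s, Rhat₀ s))
          (fun s n => (W n s, V₁ (n + 1) s, V₂ (n + 1) s)) P →
        Tendsto (fun n => tvNormSub
            (P.map fun s => filterError b₁ b₂ k₁ k₂ (R₀ s) (Rhat₀ s) (fun m => W m s) Ω
              (fun m => V₁ m s) (fun m => V₂ m s) n)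
            (π : Measure SO3))
          atTop (𝓝 0) := by
  have hF := measurable_errorStep b₁ b₂ k₁ k₂
  obtain ⟨κ, hκ⟩ : ∃ κ : Kernel SO3 SO3, κ = randomMapKernel
    (fun p => errorStep b₁ b₂ k₁ k₂ p.1 p.2) (noiseLaw ν σ₁ σ₂) := ⟨_, rfl⟩
  have hκM : IsMarkovKernel κ := hκ ▸ isMarkovKernel_randomMapKernel hF _
  have hstat : ∀ π : ProbabilityMeasure SO3,
      IsStationaryError b₁ b₂ k₁ k₂ ν σ₁ σ₂ π ↔ κ ∘ₘ (π : Measure SO3) = π := fun π => by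
    rw [IsStationaryError, hκ, comp_randomMapKernel hF]
  obtain ⟨m, δ, hm, hδ0, hδ, hmin⟩ := exists_two_step_minorization hb hk₁.ne' hk₂.ne' hσ₁ hσ₂ ν hν
    κ hκ
  obtain ⟨π, hπ, hinv⟩ := exists_invariant_of_two_step κ m δ hδ0 hδ hmin
  refine ⟨⟨π, hπ⟩, (hstat _).2 hinv, fun π' h' => Subtype.ext ?_, ?_⟩
  · exact invariant_unique_of_two_step κ m δ hδ0 hδ hmin π' π ((hstat π').1 h') hinv
  intro S _ P _ R₀ Rhat₀ W V₁ V₂ Ω hR₀ hRhat₀ hW hV₁ hV₂ hlaw hindep hindep₀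
  -- Innovation `n` pairs `W n` with the measurement noise of time `n + 1`, so that one step of the
  -- system uses exactly `N n`.
  let N : ℕ → S → SO3 × Vec3 × Vec3 := fun n s => (W n s, V₁ (n + 1) s, V₂ (n + 1) s)
  let X : ℕ → S → SO3 × SO3 := fun n s =>
    (trueAttitude (R₀ s) (fun m => W m s) Ω n,
      estimatedAttitude b₁ b₂ k₁ k₂ (R₀ s) (Rhat₀ s) (fun m => W m s) Ω (fun m => V₁ m s)
        (fun m => V₂ m s) n)
  have hN : ∀ n, Measurable (N n) := fun n => (hW n).prodMk ((hV₁ _).prodMk (hV₂ _))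
  have hS := fun n => (continuous_systemStep b₁ b₂ k₁ k₂ (Ω n)).measurable
  have hX : ∀ n s, X (n + 1) s = systemStep b₁ b₂ k₁ k₂ (Ω n) (X n s) (N n s) := fun n s => rfl
  have hfut := indepFun_future hS hN hindep (hR₀.prodMk hRhat₀) hindep₀ hX
  have hD : Measurable fun p : SO3 × SO3 => p.1 * p.2⁻¹ := measurable_fst.mul measurable_snd.inv
  have herr : ∀ n, Measurable fun s => (X n s).1 * (X n s).2⁻¹ := fun n => hD.comp (hfut n).1
  have hprob : ∀ n, IsProbabilityMeasure (P.map fun s => (X n s).1 * (X n s).2⁻¹) := fun n =>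
    Measure.isProbabilityMeasure_map (herr n).aemeasurable
  -- The pair has input-dependent transitions; only the law of its quotient evolves under the fixed
  -- kernel `κ`.
  refine tendsto_tvNormSub_of_two_step κ m δ hδ0 hδ hmin π hinv
    (fun n => P.map fun s => (X n s).1 * (X n s).2⁻¹) fun n => ?_
  have hXn := (hfut n).1
  have hXp : IsProbabilityMeasure (P.map (X n)) := Measure.isProbabilityMeasure_map hXn.aemeasurable
  -- `N n` is the coordinate at `0` of the future sequence, which is independent of `X n`.
  have hXN : P.map (fun s => (X n s, N n s)) = (P.map (X n)).prod (noiseLaw ν σ₁ σ₂) := by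
    rw [← hlaw n]
    exact ((hfut n).2.comp measurable_id (measurable_pi_apply 0)).map_prod_eq_prod_map_map
      hXn.aemeasurable (hN n).aemeasurable
  have hSD : Measurable fun q : (SO3 × SO3) × SO3 × Vec3 × Vec3 =>
      (systemStep b₁ b₂ k₁ k₂ (Ω n) q.1 q.2).1 * (systemStep b₁ b₂ k₁ k₂ (Ω n) q.1 q.2).2⁻¹ :=
    hD.comp (hS n)
  have key := map_systemStep_error b₁ b₂ k₁ k₂ (Ω n) ν σ₁ σ₂ (P.map (X n))
  rw [← hXN, ← hκ, Measure.map_map hSD (hXn.prodMk (hN n)), Measure.map_map hD hXn] at key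
  exact key
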